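/- Let $(\Omega,\Sigma,\mu)$ be a measure space and let $\Phi:\Omega\times[0,\infty)\to[0,\infty)$ be a Musielak--Orlicz integrand: $\Phi(\cdot,t)$ is measurable for every $t\ge 0$, and for almost every $x$ the function $\Phi(x,\cdot)$ is convex, $\Phi(x,0)=0$, and $\Phi(x,t)>0$ for $t>0$. For (classes of) measurable $u:\Omega\to\mathbb R$ put $\rho(u)=\int_\Omega\Phi(x,|u(x)|)\,d\mu(x)\in[0,\infty]$ and $w_\lambda(u,v)=\rho((u-v)/\lambda)$ for $\lambda>0$. Let $L^\rho=\{u:\rho(u/\lambda)<\infty\text{ for some }\lambda>0\}$ with the Luxemburg norm $\|u\|_\rho=\inf\{\lambda>0:\rho(u/\lambda)\le 1\}$, let $d_w^*(u,v)=\inf\{\lambda>0:w_\lambda(u,v)\le 1\}$, and let $\mathcal V$ be the modular uniformity on $L^\rho$, with base $V_n=\{(u,v):w_{1/n}(u,v)<1/n\}$, $n\ge 1$. Assume that $\rho$ is uniformly convex in the sense of Orlicz theory, that is: (a) $\Phi$ satisfies the $\Delta_2$-condition: there are a constant $K$ and an integrable $h\ge 0$ such that, for almost every $x$, $\Phi(x,2t)\le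 K\Phi(x,t)+h(x)$ for all $t\ge 0$; and (b) either the integrand is uniformly convex: for every $\varepsilon>0$ there is $\delta>0$ such that, for almost every $x$, $\Phi(x,\frac{s+t}2)\le(1-\delta)\frac{\Phi(x,s)+\Phi(x,t)}2$ for all $s,t\ge 0$ with $|s-t|\ge\varepsilon\max\{s,t\}$; or the modular is uniformly convex: for every $\varepsilon>0$ there is $\delta\in(0,1)$ such that for all $u,v\in L^\rho$ one has $\rho(\frac{u-v}2)\le\varepsilon\,\frac{\rho(u)+\rho(v)}2$ or $\rho(\frac{u+v}2)\le(1-\delta)\frac{\rho(u)+\rho(v)}2$. Then $d_w^*(u,v)=\|u-v\|_\rho$ on $L^\rho$, the sets $V_n$ form a base of the uniformity of $\|\cdot\|_\rho$ (so $\mathcal V$ is the norm uniformity), and $(L^\rho,\|\cdot\|_\rho)$ is a uniformly convex and reflexive Banach space. Consequently: 1. every bounded subset of $L^\rho$ is relatively compact in the weak topology, and every bounded sequence has a weakly convergent subsequence; 2. every continuous linear functional on $L^\rho$ attains its norm on the closed unit ball; 3. for every nonempty closed convex set $C\subset L^\rho$ and every $u\in L^\rho$ there is a unique point of $C$ nearest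 to $u$; 4. if $u_n\to v$ weakly and $\|u_n\|_\rho\to\|v\|_\rho$, then $\|u_n-v\|_\rho\to 0$. -/

import Mathlib

open MeasureTheory Filter Topology
open scoped ENNReal

noncomputable section

/-! ### Modular pseudometrics -/

section Modular

variable {X : Type*}

/-- The modular set `X_w^*` of `w : (0,∞) × X × X → [0,∞]` with base point `x₀`
(only the values `w l` with `0 < l` are used). -/
def modularSet (w : ℝ → X → X → ℝ≥0∞) (x₀ : X) : Set X :=
  {x | ∃ l : ℝ, 0 < l ∧ w l x x₀ < ∞}

/-- The basic metric `d_w^*(x, y) = inf {l > 0 : w_l(x, y) ≤ 1}`. -/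
def basicMetricStar (w : ℝ → X → X → ℝ≥0∞) (x y : X) : ℝ :=
  sInf {l : ℝ | 0 < l ∧ w l x y ≤ 1}

/-- The entourage `V_n = {(x, y) : w(1/n, x, y) < 1/n}`, `n ≥ 1`, of the modular uniformity
(before restriction to `X_w^* × X_w^*`). -/
def modularEntourage (w : ℝ → X → X → ℝ≥0∞) (n : ℕ) : Set (X × X) :=
  {p | w (1 / (n : ℝ)) p.1 p.2 < 1 / (n : ℝ≥0∞)}

end Modular

/-! ### Musielak–Orlicz integrands, modulars and spaces -/

/-- A (real valued, convex) Musielak–Orlicz integrand on a measure space: `Φ(·, t)` is measurable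
for every `t ≥ 0`, and for almost every `x` the function `Φ(x, ·)` is convex on `[0,∞)`,
vanishes at `0` and is positive on `(0,∞)`. Only the values `Φ x t` with `0 ≤ t` matter. -/
structure MusielakOrlicz {Ω : Type*} [MeasurableSpace Ω] (μ : Measure Ω) where
  toFun : Ω → ℝ → ℝ
  aemeasurable' : ∀ t : ℝ, 0 ≤ t → AEMeasurable (fun x => toFun x t) μ
  convexOn' : ∀ᵐ x ∂μ, ConvexOn ℝ (Set.Ici (0 : ℝ)) (toFun x)
  zero' : ∀ᵐ x ∂μ, toFun x 0 = 0
  pos' : ∀ᵐ x ∂μ, ∀ t : ℝ, 0 < t → 0 < toFun x t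

namespace MusielakOrlicz

variable {Ω : Type*} [MeasurableSpace Ω] {μ : Measure Ω}

/-- The modular `ρ(u) = ∫ Φ(x, |u(x)|) dμ(x) ∈ [0,∞]` on (classes of) measurable functions. -/
def modular (Φ : MusielakOrlicz μ) (u : Ω →ₘ[μ] ℝ) : ℝ≥0∞ :=
  ∫⁻ x, ENNReal.ofReal (Φ.toFun x |u x|) ∂μ

/-- The induced modular pseudometric `w_l(u, v) = ρ((u - v) / l)`. -/
def modularMetric (Φ : MusielakOrlicz μ) (l : ℝ) (u v : Ω →ₘ[μ] ℝ) : ℝ≥0∞ :=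
  Φ.modular (l⁻¹ • (u - v))

lemma nonneg_of (f : ℝ → ℝ) (h0 : f 0 = 0) (hp : ∀ t : ℝ, 0 < t → 0 < f t) {t : ℝ}
    (ht : 0 ≤ t) : 0 ≤ f t := by
  rcases ht.eq_or_lt with rfl | h
  · exact h0.ge
  · exact (hp t h).le

lemma scale_le (f : ℝ → ℝ) (hc : ConvexOn ℝ (Set.Ici (0 : ℝ)) f) (h0 : f 0 = 0) {a t : ℝ}
    (ha : 0 ≤ a) (ha1 : a ≤ 1) (ht : 0 ≤ t) : f (a * t) ≤ a * f t := by
  have := hc.2 (x := t) (y := 0) ht (le_refl (0 : ℝ)) ha (sub_nonneg.2 ha1) (by ring)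
  simpa [h0] using this

lemma mono_of (f : ℝ → ℝ) (hc : ConvexOn ℝ (Set.Ici (0 : ℝ)) f) (h0 : f 0 = 0)
    (hp : ∀ t : ℝ, 0 < t → 0 < f t) {s t : ℝ} (hs : 0 ≤ s) (hst : s ≤ t) : f s ≤ f t := by
  rcases (hs.trans hst).eq_or_lt with h | h
  · have : s = t := by linarith
    rw [this]
  · have h1 := scale_le f hc h0 (a := s / t) (by positivity) ((div_le_one h).2 hst) h.le
    rw [div_mul_cancel₀ _ h.ne'] at h1
    have h2 : s / t * f t ≤ 1 * f t :=
      mul_le_mul_of_nonneg_right ((div_le_one h).2 hst) (hp t h).le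
    linarith

lemma aemeasurable_comp (Φ : MusielakOrlicz μ) (u : Ω →ₘ[μ] ℝ) :
    AEMeasurable (fun x => ENNReal.ofReal (Φ.toFun x |u x|)) μ := by
  have hu : Measurable fun x => |u x| := u.measurable.abs
  have key : AEMeasurable (fun x => ⨆ q : ℚ, Set.indicator {x | 0 ≤ (q : ℝ) ∧ (q : ℝ) ≤ |u x|}
      (fun x => ENNReal.ofReal (Φ.toFun x q)) x) μ := by
    refine AEMeasurable.iSup fun q => ?_
    by_cases hq : 0 ≤ (q : ℝ)
    · refine AEMeasurable.indicator (Φ.aemeasurable' q hq).ennreal_ofReal ?_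
      simp only [hq, true_and]
      exact measurableSet_le measurable_const hu
    · simp [hq]
  refine key.congr ?_
  filter_upwards [Φ.convexOn', Φ.zero', Φ.pos'] with x hc h0 hp
  apply le_antisymm
  · refine iSup_le fun q => ?_
    by_cases hq : 0 ≤ (q : ℝ) ∧ (q : ℝ) ≤ |u x|
    · rw [Set.indicator_of_mem (by exact hq)]
      exact ENNReal.ofReal_le_ofReal (mono_of _ hc h0 hp hq.1 hq.2)
    · rw [Set.indicator_of_notMem (by exact hq)]
      exact zero_le
  · rcases (abs_nonneg (u x)).eq_or_lt with h | h
    · rw [← h, h0]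
      simp
    · have hcont : ContinuousAt (Φ.toFun x) |u x| := by
        have := hc.continuousOn_interior
        rw [interior_Ici] at this
        exact this.continuousAt (Ioi_mem_nhds h)
      refine le_of_forall_lt fun c hcl => ?_
      have hev : ∀ᶠ t in 𝓝 |u x|, c < ENNReal.ofReal (Φ.toFun x t) :=
        (ENNReal.continuous_ofReal.continuousAt.comp hcont).eventually (lt_mem_nhds hcl)
      have hev2 : ∀ᶠ t in 𝓝 |u x|, 0 < t := lt_mem_nhds h
      obtain ⟨l, hl, hlu⟩ := exists_Ioc_subset_of_mem_nhds (hev.and hev2) ⟨0, h⟩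
      obtain ⟨q, hq1, hq2⟩ := exists_rat_btwn hl
      have hq := hlu ⟨hq1, hq2.le⟩
      refine lt_of_lt_of_le hq.1 (le_trans ?_ (le_iSup _ q))
      rw [Set.indicator_of_mem (by exact ⟨hq.2.le, hq2.le⟩)]

lemma modular_convex (Φ : MusielakOrlicz μ) (u v : Ω →ₘ[μ] ℝ) {a b : ℝ} (ha : 0 ≤ a) (hb : 0 ≤ b)
    (hab : a + b = 1) : Φ.modular (a • u + b • v) ≤
      ENNReal.ofReal a * Φ.modular u + ENNReal.ofReal b * Φ.modular v := by
  unfold modular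
  rw [← lintegral_const_mul' _ _ ENNReal.ofReal_ne_top,
    ← lintegral_const_mul' _ _ ENNReal.ofReal_ne_top,
    ← lintegral_add_left' ((Φ.aemeasurable_comp u).const_mul _)]
  refine lintegral_mono_ae ?_
  filter_upwards [Φ.convexOn', Φ.zero', Φ.pos', AEEqFun.coeFn_add (a • u) (b • v),
    AEEqFun.coeFn_smul a u, AEEqFun.coeFn_smul b v] with x hc h0 hp e1 e2 e3
  have e : (a • u + b • v) x = a * u x + b * v x := by
    rw [e1, Pi.add_apply, e2, e3]
    rfl
  have hle : |(a • u + b • v) x| ≤ a * |u x| + b * |v x| := by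
    rw [e]
    refine (abs_add_le _ _).trans ?_
    rw [abs_mul, abs_mul, abs_of_nonneg ha, abs_of_nonneg hb]
  have n1 := nonneg_of _ h0 hp (abs_nonneg (u x))
  have n2 := nonneg_of _ h0 hp (abs_nonneg (v x))
  rw [← ENNReal.ofReal_mul ha, ← ENNReal.ofReal_mul hb,
    ← ENNReal.ofReal_add (by positivity) (by positivity)]
  refine ENNReal.ofReal_le_ofReal ((mono_of _ hc h0 hp (abs_nonneg _) hle).trans ?_)
  exact hc.2 (abs_nonneg (u x)) (abs_nonneg (v x)) ha hb hab

lemma modular_zero (Φ : MusielakOrlicz μ) : Φ.modular 0 = 0 := by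
  unfold modular
  rw [lintegral_congr_ae (g := fun _ => 0)]
  · simp
  · filter_upwards [Φ.zero', AEEqFun.coeFn_zero (α := Ω) (μ := μ) (β := ℝ)] with x h0 e
    rw [e]
    simp [h0]

lemma modular_neg (Φ : MusielakOrlicz μ) (u : Ω →ₘ[μ] ℝ) :
    Φ.modular (-u) = Φ.modular u := by
  unfold modular
  refine lintegral_congr_ae ?_
  filter_upwards [AEEqFun.coeFn_neg u] with x e
  rw [e]
  simp

lemma modular_scale (Φ : MusielakOrlicz μ) (u : Ω →ₘ[μ] ℝ) {a : ℝ} (ha : 0 ≤ a) (ha1 : a ≤ 1) :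
    Φ.modular (a • u) ≤ ENNReal.ofReal a * Φ.modular u := by
  have := Φ.modular_convex u 0 ha (sub_nonneg.2 ha1) (by ring)
  simpa [modular_zero] using this

lemma modular_scale_le (Φ : MusielakOrlicz μ) (u : Ω →ₘ[μ] ℝ) {a : ℝ} (ha : |a| ≤ 1) :
    Φ.modular (a • u) ≤ Φ.modular u := by
  have h : Φ.modular (a • u) = Φ.modular (|a| • u) := by
    rcases abs_choice a with h | h
    · rw [h]
    · rw [h, neg_smul, modular_neg]
  rw [h]
  refine (Φ.modular_scale u (abs_nonneg a) ha).trans ?_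
  calc _ ≤ 1 * Φ.modular u := by
        gcongr
        exact ENNReal.ofReal_le_one.2 ha
    _ = _ := one_mul _

lemma eq_zero_of_modular (Φ : MusielakOrlicz μ) (u : Ω →ₘ[μ] ℝ) (h : Φ.modular u = 0) :
    u = 0 := by
  have h1 := (lintegral_eq_zero_iff' (Φ.aemeasurable_comp u)).1 h
  apply AEEqFun.ext
  filter_upwards [h1, Φ.pos', AEEqFun.coeFn_zero (α := Ω) (μ := μ) (β := ℝ)] with x hx hp e
  rw [e]
  by_contra hne
  have := hp |u x| (abs_pos.2 hne)
  have h2 : Φ.toFun x |u x| ≤ 0 := ENNReal.ofReal_eq_zero.1 hx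
  linarith

/-- The Musielak–Orlicz space `L^ρ = X_w^*` (with base point `0`, where `w_l(u, v) = ρ((u-v)/l)`)
as a linear subspace of the space of classes of measurable functions: the `u` such that
`ρ(u / l) < ∞` for some `l > 0`. -/
def submodule (Φ : MusielakOrlicz μ) : Submodule ℝ (Ω →ₘ[μ] ℝ) where
  carrier := modularSet Φ.modularMetric 0
  zero_mem' := ⟨1, one_pos, by simp [modularMetric, modular_zero]⟩
  add_mem' := by
    rintro u v ⟨l, hl, hu⟩ ⟨m, hm, hv⟩
    refine ⟨l + m, by positivity, ?_⟩
    simp only [modularMetric, sub_zero] at *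
    have e : (l + m)⁻¹ • (u + v) = (l / (l + m)) • (l⁻¹ • u) + (m / (l + m)) • (m⁻¹ • v) := by
      rw [smul_smul, smul_smul, smul_add]
      congr 2 <;> field_simp
    rw [e]
    refine (Φ.modular_convex _ _ (by positivity) (by positivity) (by field_simp)).trans_lt ?_
    exact ENNReal.add_lt_top.2 ⟨ENNReal.mul_lt_top ENNReal.ofReal_lt_top hu,
      ENNReal.mul_lt_top ENNReal.ofReal_lt_top hv⟩
  smul_mem' := by
    rintro c u ⟨l, hl, hu⟩
    refine ⟨l * (|c| + 1), by positivity, ?_⟩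
    simp only [modularMetric, sub_zero] at *
    have e : (l * (|c| + 1))⁻¹ • (c • u) = (c / (|c| + 1)) • (l⁻¹ • u) := by
      rw [smul_smul, smul_smul]
      congr 1
      field_simp
    rw [e]
    refine (Φ.modular_scale_le _ ?_).trans_lt hu
    rw [abs_div, abs_of_pos (by positivity : 0 < |c| + 1), div_le_one (by positivity)]
    linarith

/-- The Musielak–Orlicz space `L^ρ` as a type. -/
def Space (Φ : MusielakOrlicz μ) : Type _ := Φ.submodule

instance instAddCommGroupSpace (Φ : MusielakOrlicz μ) : AddCommGroup Φ.Space :=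
  inferInstanceAs (AddCommGroup Φ.submodule)

instance instModuleSpace (Φ : MusielakOrlicz μ) : Module ℝ Φ.Space :=
  inferInstanceAs (Module ℝ Φ.submodule)

/-- The class of measurable functions underlying an element of `L^ρ`. -/
def Space.toFun {Φ : MusielakOrlicz μ} (u : Φ.Space) : Ω →ₘ[μ] ℝ := Subtype.val u

/-- The Luxemburg norm `‖u‖_ρ = inf {l > 0 : ρ(u / l) ≤ 1}`. -/
instance instNormSpace (Φ : MusielakOrlicz μ) : Norm Φ.Space where
  norm u := sInf {l : ℝ | 0 < l ∧ Φ.modular (l⁻¹ • u.toFun) ≤ 1}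

lemma exists_modular_le (Φ : MusielakOrlicz μ) (u : Φ.Space) {e : ℝ} (he : 0 < e) :
    ∃ l : ℝ, 0 < l ∧ Φ.modular (l⁻¹ • u.toFun) ≤ ENNReal.ofReal e := by
  obtain ⟨l, hl, hu⟩ := u.2
  simp only [modularMetric, sub_zero] at hu
  set R := (Φ.modular (l⁻¹ • u.toFun)).toReal with hR
  have hR' : Φ.modular (l⁻¹ • u.toFun) = ENNReal.ofReal R := (ENNReal.ofReal_toReal hu.ne).symm
  have hR0 : 0 ≤ R := ENNReal.toReal_nonneg
  have ht1 : e / (R + e) ≤ 1 := by rw [div_le_one (by positivity)]; linarith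
  refine ⟨l * ((R + e) / e), by positivity, ?_⟩
  have e1 : (l * ((R + e) / e))⁻¹ • u.toFun = (e / (R + e)) • (l⁻¹ • u.toFun) := by
    rw [smul_smul]
    congr 1
    field_simp
  rw [e1]
  refine (Φ.modular_scale _ (by positivity) ht1).trans ?_
  rw [hR', ← ENNReal.ofReal_mul (by positivity)]
  refine ENNReal.ofReal_le_ofReal ?_
  rw [div_mul_eq_mul_div, div_le_iff₀ (by positivity)]
  nlinarith

lemma norm_le_of (Φ : MusielakOrlicz μ) (u : Φ.Space) {l : ℝ} (hl : 0 < l)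
    (h : Φ.modular (l⁻¹ • u.toFun) ≤ 1) : ‖u‖ ≤ l :=
  csInf_le ⟨0, fun _ hx => hx.1.le⟩ ⟨hl, h⟩

lemma norm_nonneg_aux (Φ : MusielakOrlicz μ) (u : Φ.Space) : 0 ≤ ‖u‖ :=
  Real.sInf_nonneg fun _ hx => hx.1.le

lemma modular_le_of_norm_lt (Φ : MusielakOrlicz μ) (u : Φ.Space) {l : ℝ} (h : ‖u‖ < l) :
    0 < l ∧ Φ.modular (l⁻¹ • u.toFun) ≤ 1 := by
  obtain ⟨m0, hm0, h0⟩ := Φ.exists_modular_le u one_pos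
  obtain ⟨m, ⟨hm, hmu⟩, hml⟩ := exists_lt_of_csInf_lt
    (s := {l : ℝ | 0 < l ∧ Φ.modular (l⁻¹ • u.toFun) ≤ 1}) ⟨m0, hm0, by simpa using h0⟩ h
  have hl : 0 < l := hm.trans hml
  refine ⟨hl, ?_⟩
  have e1 : l⁻¹ • u.toFun = (m / l) • (m⁻¹ • u.toFun) := by
    rw [smul_smul]
    congr 1
    field_simp
  rw [e1]
  refine (Φ.modular_scale_le _ ?_).trans hmu
  rw [abs_of_pos (by positivity), div_le_one hl]
  exact hml.le

lemma norm_add_aux (Φ : MusielakOrlicz μ) (u v : Φ.Space) : ‖u + v‖ ≤ ‖u‖ + ‖v‖ := by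
  refine le_of_forall_pos_le_add fun e he => ?_
  obtain ⟨hl, hu⟩ := Φ.modular_le_of_norm_lt u (l := ‖u‖ + e / 2) (by linarith)
  obtain ⟨hm, hv⟩ := Φ.modular_le_of_norm_lt v (l := ‖v‖ + e / 2) (by linarith)
  set l := ‖u‖ + e / 2
  set m := ‖v‖ + e / 2
  have h : ‖u + v‖ ≤ l + m := by
    refine Φ.norm_le_of _ (by positivity) ?_
    have e1 : (l + m)⁻¹ • (u + v).toFun =
        (l / (l + m)) • (l⁻¹ • u.toFun) + (m / (l + m)) • (m⁻¹ • v.toFun) := by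
      change (l + m)⁻¹ • (u.toFun + v.toFun) = _
      rw [smul_smul, smul_smul, smul_add]
      congr 2 <;> field_simp
    rw [e1]
    refine (Φ.modular_convex _ _ (by positivity) (by positivity) (by field_simp)).trans ?_
    calc _ ≤ ENNReal.ofReal (l / (l + m)) * 1 + ENNReal.ofReal (m / (l + m)) * 1 := by gcongr
      _ = 1 := by
        rw [mul_one, mul_one, ← ENNReal.ofReal_add (by positivity) (by positivity), ← add_div,
          div_self (by positivity), ENNReal.ofReal_one]
  have h' : l + m = ‖u‖ + ‖v‖ + e := by ring
  rwa [h'] at h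

lemma norm_smul_le_aux (Φ : MusielakOrlicz μ) (c : ℝ) (u : Φ.Space) : ‖c • u‖ ≤ |c| * ‖u‖ := by
  refine le_of_forall_pos_le_add fun e he => ?_
  have hd : 0 < e / (|c| + 1) := by positivity
  obtain ⟨hl, hu⟩ := Φ.modular_le_of_norm_lt u (l := ‖u‖ + e / (|c| + 1)) (by linarith)
  set l := ‖u‖ + e / (|c| + 1) with hldef
  have h : ∀ d : ℝ, 0 < d → ‖c • u‖ ≤ (|c| + d) * l := by
    intro d hd
    refine Φ.norm_le_of _ (by positivity) ?_
    have e1 : ((|c| + d) * l)⁻¹ • (c • u).toFun = (c / (|c| + d)) • (l⁻¹ • u.toFun) := by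
      change ((|c| + d) * l)⁻¹ • (c • u.toFun) = _
      rw [smul_smul, smul_smul]
      congr 1
      field_simp
    rw [e1]
    refine (Φ.modular_scale_le _ ?_).trans hu
    rw [abs_div, abs_of_pos (by positivity : 0 < |c| + d), div_le_one (by positivity)]
    linarith
  have h2 : ‖c • u‖ ≤ |c| * l := by
    refine le_of_forall_pos_le_add fun d hd => ?_
    have := h (d / l) (by positivity)
    rwa [add_mul, div_mul_cancel₀ _ hl.ne'] at this
  have h3 : |c| * (e / (|c| + 1)) ≤ e := by
    rw [mul_div_assoc', div_le_iff₀ (by positivity)]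
    nlinarith
  calc ‖c • u‖ ≤ |c| * l := h2
    _ = |c| * ‖u‖ + |c| * (e / (|c| + 1)) := by rw [hldef, mul_add]
    _ ≤ _ := by linarith

lemma eq_zero_of_norm (Φ : MusielakOrlicz μ) (u : Φ.Space) (h : ‖u‖ = 0) : u = 0 := by
  apply Subtype.ext
  change u.toFun = 0
  apply Φ.eq_zero_of_modular
  refine le_antisymm (le_of_forall_pos_le_add fun e he => ?_) zero_le
  rw [zero_add]
  rcases eq_or_ne e ∞ with rfl | hne
  · exact le_top
  obtain ⟨d, hd⟩ : ∃ d : ℝ, d = min e.toReal 1 := ⟨_, rfl⟩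
  have hd0 : 0 < d := by
    rw [hd]
    exact lt_min (ENNReal.toReal_pos he.ne' hne) one_pos
  obtain ⟨-, hu⟩ := Φ.modular_le_of_norm_lt u (l := d) (by rw [h]; exact hd0)
  have e1 : u.toFun = d • (d⁻¹ • u.toFun) := by
    rw [smul_smul, mul_inv_cancel₀ hd0.ne', one_smul]
  rw [e1]
  refine (Φ.modular_scale _ hd0.le (hd ▸ min_le_right _ _)).trans ?_
  calc _ ≤ ENNReal.ofReal e.toReal * 1 := by
        gcongr
        exact hd ▸ min_le_left _ _
    _ = e := by rw [mul_one, ENNReal.ofReal_toReal hne]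

lemma normCore (Φ : MusielakOrlicz μ) : NormedSpace.Core ℝ Φ.Space where
  norm_nonneg := Φ.norm_nonneg_aux
  norm_triangle := Φ.norm_add_aux
  norm_smul c u := by
    refine le_antisymm (Φ.norm_smul_le_aux c u) ?_
    rcases eq_or_ne c 0 with rfl | hc
    · simpa using Φ.norm_nonneg_aux _
    · have h := Φ.norm_smul_le_aux c⁻¹ (c • u)
      rw [smul_smul, inv_mul_cancel₀ hc, one_smul, abs_inv] at h
      have hc' : 0 < |c| := abs_pos.2 hc
      rw [Real.norm_eq_abs]
      calc |c| * ‖u‖ ≤ |c| * (|c|⁻¹ * ‖c • u‖) := by gcongr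
        _ = ‖c • u‖ := by rw [mul_inv_cancel_left₀ hc'.ne']
  norm_eq_zero_iff u := by
    refine ⟨Φ.eq_zero_of_norm u, ?_⟩
    rintro rfl
    have := Φ.norm_smul_le_aux 0 (0 : Φ.Space)
    rw [zero_smul, abs_zero, zero_mul] at this
    exact le_antisymm this (Φ.norm_nonneg_aux _)

instance instNormedAddCommGroupSpace (Φ : MusielakOrlicz μ) : NormedAddCommGroup Φ.Space :=
  NormedAddCommGroup.ofCore Φ.normCore

instance instNormedSpaceSpace (Φ : MusielakOrlicz μ) : NormedSpace ℝ Φ.Space :=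
  NormedSpace.ofCore Φ.normCore

/-- The (generalized) `Δ₂` growth condition of Musielak–Orlicz theory:
`Φ(x, 2t) ≤ K Φ(x, t) + h(x)` for all `t ≥ 0` and almost every `x`, with a constant `K` and a
nonnegative integrable `h`. -/
def DeltaTwo (Φ : MusielakOrlicz μ) : Prop :=
  ∃ (K : ℝ) (h : Ω → ℝ), Integrable h μ ∧ (∀ x, 0 ≤ h x) ∧
    ∀ᵐ x ∂μ, ∀ t : ℝ, 0 ≤ t → Φ.toFun x (2 * t) ≤ K * Φ.toFun x t + h x

/-- Uniform convexity of the integrand: for every `ε > 0` there is `δ > 0` such that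
`Φ(x, (s+t)/2) ≤ (1 - δ) (Φ(x,s) + Φ(x,t)) / 2` whenever `|s - t| ≥ ε max(s, t)`. -/
def UniformlyConvexIntegrand (Φ : MusielakOrlicz μ) : Prop :=
  ∀ ε : ℝ, 0 < ε → ∃ δ : ℝ, 0 < δ ∧ ∀ᵐ x ∂μ, ∀ s t : ℝ, 0 ≤ s → 0 ≤ t → ε * max s t ≤ |s - t| →
    Φ.toFun x ((s + t) / 2) ≤ (1 - δ) * ((Φ.toFun x s + Φ.toFun x t) / 2)

/-- Uniform convexity of the modular: for every `ε > 0` there is `δ > 0` such that for all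
`u, v ∈ L^ρ` either `ρ((u-v)/2) ≤ ε (ρ(u)+ρ(v))/2` or `ρ((u+v)/2) ≤ (1-δ) (ρ(u)+ρ(v))/2`. -/
def UniformlyConvexModular (Φ : MusielakOrlicz μ) : Prop :=
  ∀ ε : ℝ, 0 < ε → ∃ δ : ℝ, 0 < δ ∧ δ < 1 ∧ ∀ u v : Φ.Space,
    Φ.modular ((2 : ℝ)⁻¹ • (u.toFun - v.toFun)) ≤
        ENNReal.ofReal ε * ((Φ.modular u.toFun + Φ.modular v.toFun) / 2) ∨
      Φ.modular ((2 : ℝ)⁻¹ • (u.toFun + v.toFun)) ≤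
        ENNReal.ofReal (1 - δ) * ((Φ.modular u.toFun + Φ.modular v.toFun) / 2)

end MusielakOrlicz

end

/-! Everything follows once the Luxemburg norm is known to be uniformly convex and complete; the
rest is general Banach space theory.

Uniform convexity passes from the integrand to the modular by integrating a pointwise inequality
(`uniformly_convex_pointwise`), and from the modular to the norm by two consequences of `Δ₂`. A
small modular forces a small norm (`DeltaTwo.exists_norm_le_of_modular_le`), and a modular at most
`1 - δ` forces a norm at most `1 - η` (`DeltaTwo.exists_norm_le_one_sub`). For unit vectors `x`, `y`
the modular dichotomy applied to `(x - y)/2` and `(x + y)/2` then becomes the norm dichotomy.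
Completeness follows from convexity, positivity of `Φ` and Fatou's lemma: a rapidly Cauchy sequence
converges almost everywhere, and modular bounds survive in the limit. That the `V_n` form a base is
a rescaling: convexity makes the modular of a contracted function at most proportionally large.

On the abstract side, one quantitative form of uniform convexity drives three results: points of
norm at most `d + η` whose sum has norm at least `2d - η` are close together. It makes the
approximants supplied by Goldstine's theorem a Cauchy filter (Milman–Pettis), makes minimizing
sequences Cauchy (nearest points), and upgrades weak to strong convergence (Radon–Riesz).
Reflexivity gives weak compactness through Banach–Alaoglu and norm attainment through Hahn–Banach in
the bidual. -/

noncomputable section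

/-! ### Uniformly convex Banach spaces: reflexivity, weak compactness, nearest points -/

section UniformConvexity

variable {E : Type*} [NormedAddCommGroup E] [NormedSpace ℝ E]

/-- Uniform convexity with approximate bounds on the norms. -/
lemma exists_forall_norm_sub_lt_of_norm_add_ge [UniformConvexSpace E] {d ε : ℝ} (hd : 0 ≤ d)
    (hε : 0 < ε) : ∃ η : ℝ, 0 < η ∧ ∀ a b : E, ‖a‖ ≤ d + η → ‖b‖ ≤ d + η →
      2 * d - η ≤ ‖a + b‖ → ‖a - b‖ < ε := by
  rcases hd.eq_or_lt with rfl | hd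
  · refine ⟨ε / 3, by positivity, fun a b ha hb _ => ?_⟩
    have := norm_sub_le a b
    linarith
  obtain ⟨δ, hδ, h⟩ := exists_forall_closed_ball_dist_add_le_two_mul_sub E
    (ε := ε / 2) (by positivity) d
  refine ⟨min d (δ / 4), by positivity, fun a b ha hb hab => ?_⟩
  set η := min d (δ / 4) with hη
  have hη0 : 0 < η := by positivity
  have hη1 : η ≤ d := min_le_left _ _
  have hη2 : η ≤ δ / 4 := min_le_right _ _
  by_contra! hcon
  -- Scaling by `c` moves `a` and `b` into the ball of radius `d`. Since `η ≤ d`, `c ≥ 1/2` and the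
  -- scaled points stay `ε / 2` apart. Also `c (2d - η) = 2d - 3cη`, which exceeds `2d - δ` because
  -- `η ≤ δ / 4`.
  set c : ℝ := d / (d + η) with hc
  have hc0 : 0 < c := by positivity
  have hcd : c * (d + η) = d := by rw [hc]; field_simp
  have hc2 : 1 / 2 ≤ c := by
    rw [hc, div_le_div_iff₀ (by norm_num) (by positivity)]
    linarith
  have hc1 : c ≤ 1 := by
    rw [hc, div_le_one (by positivity)]
    linarith
  have key : ∀ z : E, ‖c • z‖ = c * ‖z‖ := fun z => by
    rw [norm_smul, Real.norm_of_nonneg hc0.le]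
  have h1 := h (x := c • a) (by rw [key, ← hcd]; gcongr) (y := c • b)
    (by rw [key, ← hcd]; gcongr) (by
      rw [← smul_sub, key]
      nlinarith)
  rw [← smul_add, key] at h1
  nlinarith

lemma surjective_of_forall_norm_eq_one {V W : Type*} [NormedAddCommGroup V] [NormedSpace ℝ V]
    [NormedAddCommGroup W] [NormedSpace ℝ W] (T : V →L[ℝ] W)
    (h : ∀ y : W, ‖y‖ = 1 → ∃ x, T x = y) : Function.Surjective T := by
  intro y
  rcases eq_or_ne y 0 with rfl | hy
  · exact ⟨0, map_zero _⟩
  have hy' : ‖y‖ ≠ 0 := norm_ne_zero_iff.2 hy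
  obtain ⟨x, hx⟩ := h (‖y‖⁻¹ • y) (by rw [norm_smul, norm_inv, norm_norm, inv_mul_cancel₀ hy'])
  refine ⟨‖y‖ • x, ?_⟩
  rw [map_smul, hx, smul_smul, mul_inv_cancel₀ hy', one_smul]

/-- **Goldstine's theorem** for finitely many functionals. -/
lemma exists_mem_closedBall_forall_abs_sub_lt (F : StrongDual ℝ (StrongDual ℝ E)) (hF : ‖F‖ ≤ 1)
    (s : Finset (StrongDual ℝ E)) {η : ℝ} (hη : 0 < η) :
    ∃ x : E, ‖x‖ ≤ 1 ∧ ∀ g ∈ s, |g x - F g| < η := by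
  classical
  let T : E →L[ℝ] (s → ℝ) := ContinuousLinearMap.pi fun g => (g : StrongDual ℝ E)
  let p : s → ℝ := fun g => F g
  have hconv : Convex ℝ (T '' Metric.closedBall 0 1) :=
    (convex_closedBall (0 : E) 1).is_linear_image T.toLinearMap.isLinear
  have hmem : p ∈ closure (T '' Metric.closedBall 0 1) := by
    by_contra hp
    obtain ⟨f, r, hr1, hr2⟩ := geometric_hahn_banach_closed_point hconv.closure isClosed_closure hp
    -- The separating functional pulls back to a combination `G` of the functionals in `s`, so `F G
    -- = f p > r`. The bound by `r` on the unit ball gives `‖G‖ ≤ r`, against `‖F‖ ≤ 1`.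
    let G : StrongDual ℝ E := f.comp T
    have hG : G = ∑ g : s, f (Pi.single g 1) • (g : StrongDual ℝ E) := by
      ext x
      change f (T x) = _
      conv_lhs => rw [pi_eq_sum_univ' (T x), map_sum]
      simp only [map_smul, sum_apply, smul_apply]
      refine Finset.sum_congr rfl fun g _ => ?_
      rw [smul_eq_mul, smul_eq_mul, mul_comm]
      congr 2
    have hFG : F G = f p := by
      rw [hG, map_sum]
      conv_rhs => rw [pi_eq_sum_univ' p, map_sum]
      simp only [map_smul]
      refine Finset.sum_congr rfl fun g _ => ?_
      rw [smul_eq_mul, smul_eq_mul, mul_comm]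
    have hr0 : 0 < r := by
      have := hr1 (T 0) (subset_closure ⟨0, by simp, rfl⟩)
      simpa using this
    have hGr : ‖G‖ ≤ r := by
      refine ContinuousLinearMap.opNorm_le_of_unit_norm hr0.le fun x hx => ?_
      have hx1 : G x ≤ r := (hr1 (T x) (subset_closure ⟨x, by simp [hx], rfl⟩)).le
      have hx2 : G (-x) ≤ r := (hr1 (T (-x)) (subset_closure ⟨-x, by simp [hx], rfl⟩)).le
      rw [map_neg] at hx2
      exact abs_le.2 ⟨by linarith, hx1⟩
    have h1 : F G ≤ ‖G‖ := by
      refine (le_abs_self _).trans ((F.le_opNorm G).trans ?_)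
      exact mul_le_of_le_one_left (norm_nonneg _) hF
    linarith
  obtain ⟨_, ⟨x, hx, rfl⟩, hxd⟩ := Metric.mem_closure_iff.1 hmem η hη
  refine ⟨x, by simpa using hx, fun g hg => ?_⟩
  have := (dist_le_pi_dist p (T x) ⟨g, hg⟩).trans_lt hxd
  rw [Real.dist_eq, abs_sub_comm] at this
  exact this

/-- Banach–Alaoglu in the bidual: the canonical embedding carries the weak topology to the weak-*
topology, and reflexivity puts every weak-* limit point back in `E`. -/
theorem isCompact_closure_toWeakSpace_image_of_isBounded
    (hE : Function.Surjective (NormedSpace.inclusionInDoubleDual ℝ E)) {B : Set E}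
    (hB : Bornology.IsBounded B) : IsCompact (closure (toWeakSpace ℝ E '' B)) := by
  refine NormedSpace.isCompact_closure_of_isBounded ℝ E _ ?_ ?_
  · rwa [Set.preimage_image_eq _ (toWeakSpace ℝ E).injective]
  · intro F _
    obtain ⟨x, hx⟩ := hE (WeakDual.toStrongDual F)
    refine ⟨toWeakSpace ℝ E x, ?_⟩
    apply WeakDual.toStrongDual.injective
    exact hx

/-- **Eberlein–Šmulian** in a separable reflexive space. -/
theorem exists_subseq_weak_tendsto_of_separable [TopologicalSpace.SeparableSpace E]
    (hE : Function.Surjective (NormedSpace.inclusionInDoubleDual ℝ E)) {u : ℕ → E}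
    (hu : Bornology.IsBounded (Set.range u)) :
    ∃ (v : E) (k : ℕ → ℕ), StrictMono k ∧
      ∀ F : StrongDual ℝ E, Tendsto (fun n => F (u (k n))) atTop (𝓝 (F v)) := by
  set K := closure (toWeakSpace ℝ E '' Set.range u) with hK
  have hKc : IsCompact K := isCompact_closure_toWeakSpace_image_of_isBounded hE hu
  have : CompactSpace K := isCompact_iff_compactSpace.1 hKc
  choose f hf1 hf2 using fun n => exists_dual_vector'' ℝ (TopologicalSpace.denseSeq E n)
  have hcont : ∀ F : StrongDual ℝ E,
      Continuous fun x : K => F ((toWeakSpace ℝ E).symm x) := fun F =>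
    (WeakBilin.eval_continuous (topDualPairing ℝ E).flip F).comp continuous_subtype_val
  -- The norming functionals of a dense sequence separate points, so countably many weakly
  -- continuous functions metrize the compact set `K`, which is then sequentially compact.
  have hsep : ∀ z : E, (∀ n, f n z = 0) → z = 0 := by
    intro z hz
    by_contra hne
    have hz0 : 0 < ‖z‖ := norm_pos_iff.2 hne
    obtain ⟨n, hn⟩ := Metric.denseRange_iff.1 (TopologicalSpace.denseRange_denseSeq E) z (‖z‖ / 2)
      (by positivity)
    set y := TopologicalSpace.denseSeq E n
    rw [dist_eq_norm] at hn
    have h1 : ‖y‖ ≤ ‖y - z‖ := by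
      have h2 : f n (y - z) = ‖y‖ := by
        rw [map_sub, hz n, sub_zero]
        exact hf2 n
      rw [← h2]
      exact (le_abs_self _).trans (((f n).le_opNorm _).trans
        (mul_le_of_le_one_left (norm_nonneg _) (hf1 n)))
    have h3 : ‖z‖ ≤ ‖z - y‖ + ‖y‖ := by simpa using norm_add_le (z - y) y
    rw [norm_sub_rev] at h1
    linarith
  have : TopologicalSpace.MetrizableSpace K :=
    Metric.PiNatEmbed.TopologicalSpace.MetrizableSpace.of_countable_separating
      (fun n x => f n ((toWeakSpace ℝ E).symm x)) (fun n => hcont (f n)) fun x y hxy => by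
        by_contra! h
        refine hxy (Subtype.ext ((toWeakSpace ℝ E).symm.injective (sub_eq_zero.1 (hsep _ ?_))))
        intro n
        rw [map_sub, sub_eq_zero]
        exact h n
  let w : ℕ → K := fun n => ⟨toWeakSpace ℝ E (u n), subset_closure ⟨u n, ⟨n, rfl⟩, rfl⟩⟩
  obtain ⟨a, k, hk, hka⟩ := CompactSpace.tendsto_subseq w
  exact ⟨(toWeakSpace ℝ E).symm a, k, hk, fun F => ((hcont F).tendsto a).comp hka⟩

/-- In a reflexive space every functional attains its norm on the closed unit ball. -/
theorem exists_norm_le_one_apply_eq_norm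
    (hE : Function.Surjective (NormedSpace.inclusionInDoubleDual ℝ E)) (F : StrongDual ℝ E) :
    ∃ u : E, ‖u‖ ≤ 1 ∧ F u = ‖F‖ := by
  obtain ⟨G, hG1, hG2⟩ := exists_dual_vector'' ℝ F
  obtain ⟨u, rfl⟩ := hE G
  refine ⟨u, ?_, hG2⟩
  rwa [← (NormedSpace.inclusionInDoubleDualLi ℝ (E := E)).norm_map u]

variable [UniformConvexSpace E]

set_option maxSynthPendingDepth 3 in
/-- **Milman–Pettis theorem**: a uniformly convex Banach space is reflexive. -/
theorem UniformConvexSpace.surjective_inclusionInDoubleDual [CompleteSpace E] :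
    Function.Surjective (NormedSpace.inclusionInDoubleDual ℝ E) := by
  have main : ∀ F : StrongDual ℝ (StrongDual ℝ E), ‖F‖ = 1 →
      ∃ x : E, NormedSpace.inclusionInDoubleDual ℝ E x = F := by
    intro F hF
    -- The sets `B q` are the traces on the unit ball of the basic weak-* neighbourhoods of `F`.
    -- Goldstine makes them nonempty; uniform convexity makes the filter they generate norm Cauchy.
    let B : Finset (StrongDual ℝ E) × {η : ℝ // 0 < η} → Set E :=
      fun q => {x | ‖x‖ ≤ 1 ∧ ∀ g ∈ q.1, |g x - F g| < q.2}
    let L : Filter E := ⨅ q, 𝓟 (B q)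
    have hBL : ∀ q, B q ∈ L := fun q => mem_iInf_of_mem q (mem_principal_self _)
    have hne : L.NeBot := by
      classical
      refine iInf_neBot_of_directed ?_ fun q => ?_
      · intro q r
        refine ⟨(q.1 ∪ r.1, ⟨min q.2 r.2, lt_min q.2.2 r.2.2⟩), ?_, ?_⟩
        · refine principal_mono.2 fun x hx => ⟨hx.1, fun g hg => ?_⟩
          exact (hx.2 g (Finset.mem_union_left _ hg)).trans_le (min_le_left _ _)
        · refine principal_mono.2 fun x hx => ⟨hx.1, fun g hg => ?_⟩
          exact (hx.2 g (Finset.mem_union_right _ hg)).trans_le (min_le_right _ _)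
      · rw [principal_neBot_iff]
        exact exists_mem_closedBall_forall_abs_sub_lt F hF.le q.1 q.2.2
    have hcau : Cauchy L := by
      refine Metric.cauchy_iff.2 ⟨hne, fun ε hε => ?_⟩
      obtain ⟨η, hη, h⟩ := exists_forall_norm_sub_lt_of_norm_add_ge (E := E) (d := 1)
        zero_le_one hε
      -- Two losses of `η / 4` leave `g x, g y > 1 - η / 2`, hence `‖x + y‖ ≥ g (x + y) > 2 - η`.
      obtain ⟨g, hg, hgF⟩ : ∃ g : StrongDual ℝ E, ‖g‖ ≤ 1 ∧ 1 - η / 4 < F g := by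
        obtain ⟨g, hg, hgF⟩ := F.exists_lt_apply_of_lt_opNorm (r := 1 - η / 4) (by linarith)
        rcases abs_choice (F g) with h' | h'
        · exact ⟨g, hg.le, by rwa [Real.norm_eq_abs, h'] at hgF⟩
        · exact ⟨-g, by simpa using hg.le, by rwa [Real.norm_eq_abs, h', ← map_neg] at hgF⟩
      refine ⟨_, hBL ({g}, ⟨η / 4, by positivity⟩), fun x hx y hy => ?_⟩
      rw [dist_eq_norm]
      refine h x y (by linarith [hx.1]) (by linarith [hy.1]) ?_
      have hx2 := abs_lt.1 (hx.2 g (Finset.mem_singleton_self g))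
      have hy2 := abs_lt.1 (hy.2 g (Finset.mem_singleton_self g))
      have h3 : g (x + y) ≤ ‖x + y‖ :=
        (le_abs_self _).trans ((g.le_opNorm _).trans (mul_le_of_le_one_left (norm_nonneg _) hg))
      rw [map_add] at h3
      simp only at hx2 hy2
      linarith [hx2.1, hy2.1]
    obtain ⟨x, hx⟩ := CompleteSpace.complete hcau
    refine ⟨x, ?_⟩
    ext g
    rw [NormedSpace.dual_def]
    have h1 : Tendsto (fun y => g y) L (𝓝 (g x)) := (g.continuous.tendsto x).mono_left hx
    have h2 : Tendsto (fun y => g y) L (𝓝 (F g)) := by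
      refine Metric.tendsto_nhds.2 fun ε hε => ?_
      filter_upwards [hBL ({g}, ⟨ε, hε⟩)] with y hy
      exact hy.2 g (Finset.mem_singleton_self g)
    exact tendsto_nhds_unique h1 h2
  exact surjective_of_forall_norm_eq_one (NormedSpace.inclusionInDoubleDual ℝ E) main

/-- **Eberlein–Šmulian** for uniformly convex Banach spaces. -/
theorem UniformConvexSpace.exists_subseq_weak_tendsto [CompleteSpace E] {u : ℕ → E}
    (hu : Bornology.IsBounded (Set.range u)) :
    ∃ (v : E) (k : ℕ → ℕ), StrictMono k ∧
      ∀ F : StrongDual ℝ E, Tendsto (fun n => F (u (k n))) atTop (𝓝 (F v)) := by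
  -- The closed span is separable and inherits completeness and uniform convexity, so it is itself
  -- reflexive. Functionals on `E` restrict to it, so weak convergence in `Y` suffices.
  let Y : Submodule ℝ E := (Submodule.span ℝ (Set.range u)).topologicalClosure
  have hmem : ∀ n, u n ∈ Y := fun n =>
    Submodule.le_topologicalClosure _ (Submodule.subset_span ⟨n, rfl⟩)
  have : CompleteSpace Y := (Submodule.isClosed_topologicalClosure _).completeSpace_coe
  have : UniformConvexSpace Y := ⟨fun ε hε => by
    obtain ⟨δ, hδ, h⟩ := exists_forall_sphere_dist_add_le_two_sub E hε
    exact ⟨δ, hδ, fun x hx y hy hxy => h (x := (x : E)) hx (y := (y : E)) hy hxy⟩⟩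
  have : TopologicalSpace.SeparableSpace Y :=
    ((Set.countable_range u).isSeparable.span (R := ℝ)).closure.separableSpace
  let w : ℕ → Y := fun n => ⟨u n, hmem n⟩
  have hw : Bornology.IsBounded (Set.range w) := by
    obtain ⟨C, hC⟩ := hu.exists_norm_le
    refine (isBounded_iff_forall_norm_le).2 ⟨C, ?_⟩
    rintro _ ⟨n, rfl⟩
    exact hC _ ⟨n, rfl⟩
  obtain ⟨v, k, hk, h⟩ := exists_subseq_weak_tendsto_of_separable
    UniformConvexSpace.surjective_inclusionInDoubleDual hw
  exact ⟨v, k, hk, fun F => h (F.comp Y.subtypeL)⟩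

/-- In a uniformly convex Banach space nonempty closed convex sets have unique nearest points. -/
theorem UniformConvexSpace.existsUnique_nearest [CompleteSpace E] {C : Set E} (hne : C.Nonempty)
    (hcl : IsClosed C) (hconv : Convex ℝ C) (u : E) :
    ∃! v : E, v ∈ C ∧ ∀ z ∈ C, dist u v ≤ dist u z := by
  set d := Metric.infDist u C with hd
  have hd0 : 0 ≤ d := Metric.infDist_nonneg
  have hle : ∀ z ∈ C, d ≤ dist u z := fun z hz => Metric.infDist_le_dist_of_mem hz
  -- Almost nearest points are close together: their midpoint lies in `C`, so `‖(u - a) + (u - b)‖ ≥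
  -- 2d`. This yields both the Cauchy property and uniqueness.
  have close : ∀ ε : ℝ, 0 < ε → ∃ η : ℝ, 0 < η ∧ ∀ a ∈ C, ∀ b ∈ C, dist u a ≤ d + η →
      dist u b ≤ d + η → dist a b < ε := by
    intro ε hε
    obtain ⟨η, hη, h⟩ := exists_forall_norm_sub_lt_of_norm_add_ge (E := E) hd0 hε
    refine ⟨η, hη, fun a ha b hb hua hub => ?_⟩
    rw [dist_eq_norm] at hua hub
    have hmid : (1 / 2 : ℝ) • a + (1 / 2 : ℝ) • b ∈ C :=
      hconv ha hb (by norm_num) (by norm_num) (by norm_num)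
    have h1 := hle _ hmid
    have h2 : u - ((1 / 2 : ℝ) • a + (1 / 2 : ℝ) • b) = (1 / 2 : ℝ) • ((u - a) + (u - b)) := by
      module
    rw [dist_eq_norm, h2, norm_smul, Real.norm_of_nonneg (by norm_num)] at h1
    have := h (u - a) (u - b) hua hub (by linarith)
    rwa [sub_sub_sub_cancel_left, ← dist_eq_norm, dist_comm] at this
  have hex : ∀ n : ℕ, ∃ z ∈ C, dist u z < d + 1 / ((n : ℝ) + 1) := fun n =>
    (Metric.infDist_lt_iff hne).1 (by rw [← hd]; linarith [Nat.one_div_pos_of_nat (α := ℝ) (n := n)])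
  choose z hzC hz using hex
  have hcau : CauchySeq z := by
    refine Metric.cauchySeq_iff.2 fun ε hε => ?_
    obtain ⟨η, hη, h⟩ := close ε hε
    obtain ⟨N, hN⟩ := exists_nat_one_div_lt hη
    have hzN : ∀ n ≥ N, dist u (z n) ≤ d + η := fun n hn => by
      have := Nat.one_div_le_one_div (α := ℝ) hn
      linarith [hz n]
    exact ⟨N, fun m hm n hn => h _ (hzC m) _ (hzC n) (hzN m hm) (hzN n hn)⟩
  obtain ⟨v, hv⟩ := cauchySeq_tendsto_of_complete hcau
  have hvC : v ∈ C := hcl.mem_of_tendsto hv (Eventually.of_forall hzC)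
  have hvd : dist u v ≤ d := by
    have h1 : Tendsto (fun n => dist u (z n)) atTop (𝓝 (dist u v)) := tendsto_const_nhds.dist hv
    have h2 : Tendsto (fun n : ℕ => d + 1 / ((n : ℝ) + 1)) atTop (𝓝 (d + 0)) :=
      tendsto_const_nhds.add tendsto_one_div_add_atTop_nhds_zero_nat
    rw [add_zero] at h2
    exact le_of_tendsto_of_tendsto' h1 h2 fun n => (hz n).le
  refine ⟨v, ⟨hvC, fun z hz => hvd.trans (hle z hz)⟩, ?_⟩
  rintro y ⟨hyC, hy⟩
  by_contra hyv
  obtain ⟨η, hη, h⟩ := close _ (dist_pos.2 hyv)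
  exact lt_irrefl _ (h y hyC v hvC (by linarith [hy v hvC]) (by linarith))

/-- **Radon–Riesz property** of uniformly convex spaces. -/
theorem UniformConvexSpace.tendsto_of_weak_tendsto_of_norm_tendsto {u : ℕ → E} {v : E}
    (hw : ∀ F : StrongDual ℝ E, Tendsto (fun n => F (u n)) atTop (𝓝 (F v)))
    (hn : Tendsto (fun n => ‖u n‖) atTop (𝓝 ‖v‖)) : Tendsto u atTop (𝓝 v) := by
  refine Metric.tendsto_nhds.2 fun ε hε => ?_
  obtain ⟨η, hη, h⟩ := exists_forall_norm_sub_lt_of_norm_add_ge (E := E) (norm_nonneg v) hε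
  -- Testing weak convergence on a functional norming `v` gives `‖u n + v‖ ≥ g (u n) + g v > 2‖v‖ -
  -- η` eventually.
  obtain ⟨g, hg, hgv⟩ := exists_dual_vector'' ℝ v
  have hgv' : g v = ‖v‖ := hgv
  filter_upwards [hn.eventually (gt_mem_nhds (lt_add_of_pos_right ‖v‖ hη)),
    (hw g).eventually (lt_mem_nhds (sub_lt_self (g v) hη))] with n h1 h2
  rw [dist_eq_norm]
  refine h _ _ h1.le (by linarith) ?_
  have h3 : g (u n + v) ≤ ‖u n + v‖ :=
    (le_abs_self _).trans ((g.le_opNorm _).trans (mul_le_of_le_one_left (norm_nonneg _) hg))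
  rw [map_add] at h3
  linarith

end UniformConvexity

/-! ### Modular convergence and the Luxemburg norm -/

namespace MusielakOrlicz

variable {Ω : Type*} [MeasurableSpace Ω] {μ : Measure Ω}

/-- Replaces continuity of `f` at the endpoint `0`, where continuity of convex functions on the
interior says nothing. -/
lemma eventually_apply_mul_le (f : ℝ → ℝ) (hc : ConvexOn ℝ (Set.Ici (0 : ℝ)) f) (h0 : f 0 = 0)
    {t : ℕ → ℝ} (ht : ∀ n, 0 ≤ t n) (hlim : Tendsto t atTop (𝓝 0)) {c : ℝ} (hc0 : 0 ≤ c) :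
    ∀ᶠ n in atTop, f (c * t n) ≤ t n * f c := by
  filter_upwards [hlim.eventually (gt_mem_nhds one_pos)] with n hn
  rw [mul_comm]
  exact scale_le f hc h0 (ht n) hn.le hc0

/-- If the modulars of a sequence are summable, the sequence tends to `0` almost everywhere. -/
lemma ae_tendsto_zero_of_tsum_modular (Φ : MusielakOrlicz μ) (u : ℕ → Ω →ₘ[μ] ℝ)
    (h : ∑' n, Φ.modular (u n) ≠ ∞) : ∀ᵐ x ∂μ, Tendsto (fun n => |u n x|) atTop (𝓝 0) := by
  unfold modular at h
  rw [← lintegral_tsum fun n => Φ.aemeasurable_comp (u n)] at h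
  have h1 := ae_lt_top' (AEMeasurable.tsum fun n => Φ.aemeasurable_comp (u n)) h
  filter_upwards [h1, Φ.convexOn', Φ.zero', Φ.pos'] with x hx hc h0 hp
  have h2 := ENNReal.tendsto_atTop_zero_of_tsum_ne_top hx.ne
  refine Metric.tendsto_nhds.2 fun ε hε => ?_
  -- `Φ(x, |u n x|) < Φ(x, ε)` eventually, because `Φ(x, ε) > 0`; monotonicity then gives `|u n x| <
  -- ε`.
  filter_upwards [h2.eventually (gt_mem_nhds (ENNReal.ofReal_pos.2 (hp ε hε)))] with n hn
  rw [Real.dist_eq, sub_zero, abs_abs]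
  by_contra! hcon
  exact (ENNReal.ofReal_le_ofReal (mono_of _ hc h0 hp hε.le hcon)).not_gt hn

/-- Fatou's lemma for the modular. -/
lemma modular_le_of_ae_tendsto (Φ : MusielakOrlicz μ) {u : ℕ → Ω →ₘ[μ] ℝ} {v : Ω →ₘ[μ] ℝ}
    {c : ℝ≥0∞} (hu : ∀ᶠ n in atTop, Φ.modular (u n) ≤ c)
    (h : ∀ᵐ x ∂μ, Tendsto (fun n => u n x) atTop (𝓝 (v x))) : Φ.modular v ≤ c := by
  calc Φ.modular v ≤ ∫⁻ x, liminf (fun n => ENNReal.ofReal (Φ.toFun x |u n x|)) atTop ∂μ := by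
        refine lintegral_mono_ae ?_
        filter_upwards [h, Φ.convexOn', Φ.zero'] with x hx hc h0
        rcases (abs_nonneg (v x)).eq_or_lt with h' | h'
        · rw [← h', h0]
          simp
        · have hcont : ContinuousAt (Φ.toFun x) |v x| := by
            have := hc.continuousOn_interior
            rw [interior_Ici] at this
            exact this.continuousAt (Ioi_mem_nhds h')
          exact (((ENNReal.continuous_ofReal.tendsto _).comp (hcont.tendsto.comp hx.abs)).liminf_eq).ge
    _ ≤ liminf (fun n => Φ.modular (u n)) atTop :=
        lintegral_liminf_le' fun n => Φ.aemeasurable_comp (u n)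
    _ ≤ c := by
        refine (liminf_le_liminf hu).trans ?_
        simp

lemma ae_toFun_smul (c : ℝ) (u : Ω →ₘ[μ] ℝ) : ∀ᵐ x ∂μ, (c • u) x = c * u x := by
  filter_upwards [AEEqFun.coeFn_smul c u] with x hx
  rw [hx]
  rfl

/-- By Fatou the bound survives at the infimum itself: the multiples `u / (1 + 1/(n+1))` have
modular at most `1` and tend to `u`. -/
lemma modular_le_one_of_norm_le_one (Φ : MusielakOrlicz μ) (u : Φ.Space) (h : ‖u‖ ≤ 1) :
    Φ.modular u.toFun ≤ 1 := by
  refine Φ.modular_le_of_ae_tendsto (u := fun n : ℕ => (1 + 1 / ((n : ℝ) + 1))⁻¹ • u.toFun)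
    (Eventually.of_forall fun n => (Φ.modular_le_of_norm_lt u
      (h.trans_lt (lt_add_of_pos_right 1 Nat.one_div_pos_of_nat))).2) ?_
  filter_upwards [ae_all_iff.2 fun n : ℕ => ae_toFun_smul (1 + 1 / ((n : ℝ) + 1))⁻¹ u.toFun]
    with x hx
  simp only [hx]
  have h1 : Tendsto (fun n : ℕ => (1 + 1 / ((n : ℝ) + 1))⁻¹) atTop (𝓝 (1 + 0)⁻¹) :=
    (tendsto_const_nhds.add tendsto_one_div_add_atTop_nhds_zero_nat).inv₀ (by norm_num)
  simpa using h1.mul_const (u.toFun x)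

lemma modular_smul_le_of_norm_lt (Φ : MusielakOrlicz μ) (u : Φ.Space) {a b : ℝ} (ha : 0 < a)
    (hab : a * b ≤ 1) (h : ‖u‖ < b) : Φ.modular (a • u.toFun) ≤ ENNReal.ofReal (a * b) := by
  obtain ⟨hb, h1⟩ := Φ.modular_le_of_norm_lt u h
  have e : a • u.toFun = (a * b) • (b⁻¹ • u.toFun) := by
    rw [smul_smul]
    congr 1
    field_simp
  rw [e]
  refine (Φ.modular_scale _ (by positivity) hab).trans ?_
  exact mul_le_of_le_one_right' h1

/-! ### Consequences of the `Δ₂` condition -/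

/-- Iterates of the `Δ₂` condition. -/
lemma DeltaTwo.exists_pow {Φ : MusielakOrlicz μ} (hΔ : Φ.DeltaTwo) (k : ℕ) :
    ∃ (K : ℝ) (h : Ω → ℝ), 0 ≤ K ∧ Integrable h μ ∧ (∀ x, 0 ≤ h x) ∧
      ∀ᵐ x ∂μ, ∀ t : ℝ, 0 ≤ t → Φ.toFun x (2 ^ k * t) ≤ K * Φ.toFun x t + h x := by
  induction k with
  | zero => exact ⟨1, 0, zero_le_one, integrable_zero _ _ _, fun _ => le_rfl, by simp⟩
  | succ k ih =>
    obtain ⟨K, h, hK, hi, hn, hh⟩ := ih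
    obtain ⟨K', h', hi', hn', hh'⟩ := hΔ
    refine ⟨|K'| * K, fun x => |K'| * h x + h' x, by positivity, (hi.const_mul _).add hi',
      fun x => add_nonneg (mul_nonneg (abs_nonneg _) (hn x)) (hn' x), ?_⟩
    filter_upwards [hh, hh', Φ.zero', Φ.pos'] with x hx hx' h0 hp t ht
    have h1 := hx' (2 ^ k * t) (by positivity)
    have h2 := hx t ht
    have h3 := nonneg_of _ h0 hp (t := 2 ^ k * t) (by positivity)
    calc Φ.toFun x (2 ^ (k + 1) * t) = Φ.toFun x (2 * (2 ^ k * t)) := by congr 1; ring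
      _ ≤ K' * Φ.toFun x (2 ^ k * t) + h' x := h1
      _ ≤ |K'| * Φ.toFun x (2 ^ k * t) + h' x := by gcongr; exact le_abs_self _
      _ ≤ |K'| * (K * Φ.toFun x t + h x) + h' x := by gcongr
      _ = _ := by ring

lemma DeltaTwo.exists_modular_two_smul_le {Φ : MusielakOrlicz μ} (hΔ : Φ.DeltaTwo) :
    ∃ K H : ℝ, 0 ≤ K ∧ 0 ≤ H ∧ ∀ u : Ω →ₘ[μ] ℝ,
      Φ.modular ((2 : ℝ) • u) ≤ ENNReal.ofReal K * Φ.modular u + ENNReal.ofReal H := by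
  -- The iterate `k = 1` is `Δ₂` itself with the constant made nonnegative.
  obtain ⟨K, h, hK, hi, hn, hh⟩ := hΔ.exists_pow 1
  refine ⟨K, ∫ x, h x ∂μ, hK, integral_nonneg hn, fun u => ?_⟩
  rw [ofReal_integral_eq_lintegral_ofReal hi (Eventually.of_forall hn)]
  unfold modular
  rw [← lintegral_const_mul' _ _ ENNReal.ofReal_ne_top,
    ← lintegral_add_left' ((Φ.aemeasurable_comp u).const_mul _)]
  refine lintegral_mono_ae ?_
  filter_upwards [hh, ae_toFun_smul 2 u, Φ.zero', Φ.pos'] with x hx e h0 hp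
  rw [e, abs_mul, abs_two, ← ENNReal.ofReal_mul hK, ← ENNReal.ofReal_add
    (mul_nonneg hK (nonneg_of _ h0 hp (abs_nonneg _))) (hn x)]
  exact ENNReal.ofReal_le_ofReal (by simpa using hx |u x| (abs_nonneg _))

/-- Dominated convergence: iterated `Δ₂` bounds every `Φ(x, 2^k |u n x|)` by `K ∑ Φ(x, |u m x|) + g
x`, whose integral is finite by summability. -/
lemma DeltaTwo.tendsto_modular_of_tsum {Φ : MusielakOrlicz μ} (hΔ : Φ.DeltaTwo)
    (u : ℕ → Ω →ₘ[μ] ℝ) (h : ∑' n, Φ.modular (u n) ≠ ∞) (k : ℕ) :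
    Tendsto (fun n => Φ.modular ((2 ^ k : ℝ) • u n)) atTop (𝓝 0) := by
  obtain ⟨K, g, hK, hi, hn, hh⟩ := hΔ.exists_pow k
  have h0' : (0 : ℝ≥0∞) = ∫⁻ _ : Ω, 0 ∂μ := by simp
  rw [h0']
  refine tendsto_lintegral_of_dominated_convergence'
    (fun x => ENNReal.ofReal K * ∑' n, ENNReal.ofReal (Φ.toFun x |u n x|) + ENNReal.ofReal (g x))
    (fun n => Φ.aemeasurable_comp _) (fun n => ?_) ?_ ?_
  · filter_upwards [hh, ae_toFun_smul (2 ^ k) (u n), Φ.zero', Φ.pos'] with x hx e h0 hp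
    rw [e, abs_mul, abs_of_pos (by positivity : (0 : ℝ) < 2 ^ k)]
    calc _ ≤ ENNReal.ofReal (K * Φ.toFun x |u n x| + g x) :=
          ENNReal.ofReal_le_ofReal (hx _ (abs_nonneg _))
      _ = ENNReal.ofReal K * ENNReal.ofReal (Φ.toFun x |u n x|) + ENNReal.ofReal (g x) := by
          rw [ENNReal.ofReal_add (mul_nonneg hK (nonneg_of _ h0 hp (abs_nonneg _))) (hn x),
            ENNReal.ofReal_mul hK]
      _ ≤ _ := by
          gcongr
          exact ENNReal.le_tsum n
  · rw [lintegral_add_left' ((AEMeasurable.tsum fun n =>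
      Φ.aemeasurable_comp (u n)).const_mul _), lintegral_const_mul' _ _ ENNReal.ofReal_ne_top,
      lintegral_tsum fun n => Φ.aemeasurable_comp (u n)]
    exact ENNReal.add_ne_top.2 ⟨ENNReal.mul_ne_top ENNReal.ofReal_ne_top h, by
      rw [← ofReal_integral_eq_lintegral_ofReal hi (Eventually.of_forall hn)]
      exact ENNReal.ofReal_ne_top⟩
  · filter_upwards [Φ.ae_tendsto_zero_of_tsum_modular u h, Φ.convexOn', Φ.zero', Φ.pos',
      ae_all_iff.2 fun n => ae_toFun_smul (2 ^ k) (u n)] with x hx hc h0 hp e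
    simp only [e, abs_mul, abs_of_pos (by positivity : (0 : ℝ) < 2 ^ k)]
    have h1 : Tendsto (fun n => ENNReal.ofReal (|u n x| * Φ.toFun x (2 ^ k))) atTop (𝓝 0) := by
      have := (ENNReal.continuous_ofReal.tendsto _).comp (hx.mul_const (Φ.toFun x (2 ^ k)))
      simp only [zero_mul, ENNReal.ofReal_zero] at this
      exact this
    refine tendsto_of_tendsto_of_tendsto_of_le_of_le' tendsto_const_nhds h1
      (Eventually.of_forall fun _ => zero_le) ?_
    filter_upwards [eventually_apply_mul_le _ hc h0 (fun n => abs_nonneg (u n x)) hx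
      (by positivity : (0 : ℝ) ≤ 2 ^ k)] with n hn
    exact ENNReal.ofReal_le_ofReal hn

/-- Under `Δ₂` a small modular forces a small norm. -/
lemma DeltaTwo.exists_norm_le_of_modular_le {Φ : MusielakOrlicz μ} (hΔ : Φ.DeltaTwo) {ε : ℝ}
    (hε : 0 < ε) : ∃ α : ℝ, 0 < α ∧ ∀ u : Φ.Space, Φ.modular u.toFun ≤ ENNReal.ofReal α →
      ‖u‖ ≤ ε := by
  -- The additive term `h` in `Δ₂` does not shrink with the modular, so a direct estimate fails;
  -- counterexamples with modulars at most `2^{-n}` are summable and reduce to dominated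
  -- convergence.
  by_contra! hcon
  choose u hu hun using fun n : ℕ => hcon ((1 / 2) ^ n) (by positivity)
  obtain ⟨k, hk⟩ := exists_pow_lt_of_lt_one hε (by norm_num : (1 / 2 : ℝ) < 1)
  have hsum : ∑' n, Φ.modular (u n).toFun ≠ ∞ := by
    refine ne_top_of_le_ne_top ?_ (ENNReal.tsum_le_tsum hu)
    rw [← ENNReal.ofReal_tsum_of_nonneg (fun n => by positivity)
      (summable_geometric_of_lt_one (by norm_num) (by norm_num))]
    exact ENNReal.ofReal_ne_top
  obtain ⟨n, hn⟩ := ((hΔ.tendsto_modular_of_tsum _ hsum k).eventually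
    (gt_mem_nhds one_pos)).exists
  have h1 : ‖u n‖ ≤ (1 / 2) ^ k := Φ.norm_le_of _ (by positivity) (by
    rw [← inv_pow, one_div, inv_inv]
    exact hn.le)
  exact (h1.trans hk.le).not_gt (hun n)

/-! ### Uniform convexity: from the integrand to the modular to the norm -/

/-- If `a` and `b` are far apart, the gain `δ` in the sum term pays for the difference term, which
convexity bounds by the mean. If they are close, the difference term is at most `η` times the mean.
Having both cases in one linear inequality allows integration. -/
lemma uniformly_convex_pointwise (f : ℝ → ℝ) (hc : ConvexOn ℝ (Set.Ici (0 : ℝ)) f) (h0 : f 0 = 0)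
    (hp : ∀ t : ℝ, 0 < t → 0 < f t) {δ η : ℝ} (hδ : 0 ≤ δ) (hδ1 : δ ≤ 1) (hη : 0 ≤ η)
    (hη1 : η ≤ 1) (h : ∀ s t : ℝ, 0 ≤ s → 0 ≤ t → η * max s t ≤ |s - t| →
      f ((s + t) / 2) ≤ (1 - δ) * ((f s + f t) / 2)) (a b : ℝ) :
    δ * f (2⁻¹ * |a - b|) + f (2⁻¹ * |a + b|) ≤ (1 + δ * η) * ((f |a| + f |b|) / 2) := by
  have ha := abs_nonneg a
  have hb := abs_nonneg b
  have na := nonneg_of f h0 hp ha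
  have nb := nonneg_of f h0 hp hb
  have hmid : ∀ r : ℝ, 0 ≤ r → r ≤ |a| + |b| → f (2⁻¹ * r) ≤ (f |a| + f |b|) / 2 := by
    intro r hr hr'
    have h1 : f (2⁻¹ * r) ≤ f ((1 / 2 : ℝ) • |a| + (1 / 2 : ℝ) • |b|) :=
      mono_of f hc h0 hp (by positivity) (by simp only [smul_eq_mul]; linarith)
    have h2 := hc.2 (Set.mem_Ici.2 ha) (Set.mem_Ici.2 hb) (by norm_num : (0 : ℝ) ≤ 1 / 2)
      (by norm_num : (0 : ℝ) ≤ 1 / 2) (by norm_num)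
    simp only [smul_eq_mul] at h1 h2
    linarith
  have hm : f (max |a| |b|) ≤ f |a| + f |b| := by
    rcases max_choice |a| |b| with e | e <;> rw [e] <;> linarith
  have hm0 : 0 ≤ max |a| |b| := ha.trans (le_max_left _ _)
  rcases le_or_gt (η * max |a| |b|) |a - b| with hcase | hcase
  · have h1 := hmid _ (abs_nonneg (a - b)) (abs_sub a b)
    suffices f (2⁻¹ * |a + b|) ≤ (1 - δ) * ((f |a| + f |b|) / 2) by
      nlinarith [mul_le_mul_of_nonneg_left h1 hδ, mul_nonneg (mul_nonneg hδ hη) (add_nonneg na nb)]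
    rcases le_total 0 (a * b) with hab | hab
    · have e1 : |a + b| = |a| + |b| := (abs_add_eq_add_abs_iff a b).2 (by
        rcases mul_nonneg_iff.1 hab with h | h
        · exact Or.inl h
        · exact Or.inr h)
      have e2 : |a - b| = |(|a| - |b|)| := by
        rcases mul_nonneg_iff.1 hab with ⟨h, h'⟩ | ⟨h, h'⟩
        · rw [abs_of_nonneg h, abs_of_nonneg h']
        · rw [abs_of_nonpos h, abs_of_nonpos h', ← abs_neg]
          congr 1
          ring
      have := h |a| |b| ha hb (e2 ▸ hcase)
      rwa [e1, mul_comm, ← div_eq_mul_inv]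
    · have e1 : |a + b| ≤ max |a| |b| := by
        rcases mul_nonpos_iff.1 hab with ⟨h, h'⟩ | ⟨h, h'⟩
        · rw [abs_of_nonneg h, abs_of_nonpos h', abs_le]
          constructor <;> linarith [le_max_left a (-b), le_max_right a (-b)]
        · rw [abs_of_nonpos h, abs_of_nonneg h', abs_le]
          constructor <;> linarith [le_max_left (-a) b, le_max_right (-a) b]
      -- For opposite signs `|a + b|` is at most the larger modulus, so the pair `(max, 0)` serves
      -- instead; it is separated since `η ≤ 1`.
      have h2 := h (max |a| |b|) 0 hm0 le_rfl (by
        rw [sub_zero, max_eq_left hm0, abs_of_nonneg hm0]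
        exact mul_le_of_le_one_left hm0 hη1)
      rw [add_zero, h0, add_zero] at h2
      have h3 : f (2⁻¹ * |a + b|) ≤ f (max |a| |b| / 2) :=
        mono_of f hc h0 hp (by positivity) (by linarith)
      nlinarith
  · have h1 : f (2⁻¹ * |a - b|) ≤ η * f (max |a| |b|) / 2 := by
      have h2 : f (2⁻¹ * |a - b|) ≤ f ((η / 2) * max |a| |b|) :=
        mono_of f hc h0 hp (by positivity) (by linarith)
      have h3 := scale_le f hc h0 (a := η / 2) (by positivity) (by linarith) hm0
      linarith
    have h2 := hmid _ (abs_nonneg (a + b)) (abs_add_le a b)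
    have h3 : f (2⁻¹ * |a - b|) ≤ η * (f |a| + f |b|) / 2 :=
      h1.trans (by gcongr)
    nlinarith [mul_le_mul_of_nonneg_left h3 hδ]

/-- Uniform convexity of the integrand implies uniform convexity of the modular. -/
lemma UniformlyConvexIntegrand.uniformlyConvexModular {Φ : MusielakOrlicz μ}
    (h : Φ.UniformlyConvexIntegrand) : Φ.UniformlyConvexModular := by
  intro ε hε
  -- With `M` the mean of the two modulars, failure of both alternatives would make the left side of
  -- `key` exceed `δεM + (1 - δη)M`, and `ε ≥ 2η` makes this at least `(1 + δη)M`.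
  obtain ⟨η, hη⟩ : ∃ η, η = min 1 (ε / 2) := ⟨_, rfl⟩
  have hη0 : 0 < η := by rw [hη]; positivity
  have hη1 : η ≤ 1 := hη ▸ min_le_left _ _
  have hη2 : 2 * η ≤ ε := by
    have : η ≤ ε / 2 := hη ▸ min_le_right _ _
    linarith
  obtain ⟨δ₀, hδ₀, hδΦ⟩ := h η hη0
  obtain ⟨δ, hδ⟩ : ∃ δ, δ = min δ₀ (1 / 2) := ⟨_, rfl⟩
  have hδ0 : 0 < δ := by rw [hδ]; positivity
  have hδ1 : δ ≤ 1 / 2 := hδ ▸ min_le_right _ _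
  have hδη : δ * η < 1 := by nlinarith
  refine ⟨δ * η, by positivity, hδη, fun u v => ?_⟩
  set p := u.toFun
  set q := v.toFun
  have key : ENNReal.ofReal δ * Φ.modular ((2 : ℝ)⁻¹ • (p - q)) +
      Φ.modular ((2 : ℝ)⁻¹ • (p + q)) ≤
      ENNReal.ofReal (1 + δ * η) * ((Φ.modular p + Φ.modular q) / 2) := by
    have e2 : (2 : ℝ≥0∞)⁻¹ = ENNReal.ofReal 2⁻¹ := by
      rw [ENNReal.ofReal_inv_of_pos two_pos]
      simp
    rw [div_eq_mul_inv, mul_comm _ (2⁻¹ : ℝ≥0∞), ← mul_assoc, e2,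
      ← ENNReal.ofReal_mul (by positivity)]
    unfold modular
    rw [← lintegral_add_left' (Φ.aemeasurable_comp p),
      ← lintegral_const_mul' _ _ ENNReal.ofReal_ne_top,
      ← lintegral_const_mul' _ _ ENNReal.ofReal_ne_top,
      ← lintegral_add_left' ((Φ.aemeasurable_comp _).const_mul _)]
    refine lintegral_mono_ae ?_
    filter_upwards [hδΦ, Φ.convexOn', Φ.zero', Φ.pos', ae_toFun_smul 2⁻¹ (p - q),
      ae_toFun_smul 2⁻¹ (p + q), AEEqFun.coeFn_sub p q, AEEqFun.coeFn_add p q]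
      with x hx hc h0 hp e3 e4 e5 e6
    rw [e3, e4, e5, e6, Pi.sub_apply, Pi.add_apply, abs_mul, abs_mul,
      abs_of_pos (by norm_num : (0 : ℝ) < 2⁻¹)]
    have n1 : ∀ t : ℝ, 0 ≤ t → 0 ≤ Φ.toFun x t := fun t ht => nonneg_of _ h0 hp ht
    rw [← ENNReal.ofReal_mul hδ0.le, ← ENNReal.ofReal_add
      (mul_nonneg hδ0.le (n1 _ (by positivity))) (n1 _ (by positivity)),
      ← ENNReal.ofReal_add (n1 _ (abs_nonneg _)) (n1 _ (abs_nonneg _)),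
      ← ENNReal.ofReal_mul (by positivity)]
    refine ENNReal.ofReal_le_ofReal ?_
    have := uniformly_convex_pointwise (Φ.toFun x) hc h0 hp hδ0.le (by linarith) hη0.le hη1
      (fun s t hs ht hst => (hx s t hs ht hst).trans (by
        have : δ ≤ δ₀ := hδ ▸ min_le_left _ _
        have := n1 s hs
        have := n1 t ht
        gcongr)) (p x) (q x)
    linarith
  set M := (Φ.modular p + Φ.modular q) / 2
  rcases eq_or_ne M ∞ with hM | hM
  · right
    rw [hM, ENNReal.mul_top (ENNReal.ofReal_pos.2 (by linarith)).ne']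
    exact le_top
  · by_contra! hcon
    obtain ⟨h1, h2⟩ := hcon
    have hfin : ENNReal.ofReal (1 + δ * η) * M ≠ ∞ := ENNReal.mul_ne_top ENNReal.ofReal_ne_top hM
    obtain ⟨h3, h4⟩ := ENNReal.add_ne_top.1 (ne_top_of_le_ne_top hfin key)
    have h5 : Φ.modular ((2 : ℝ)⁻¹ • (p - q)) ≠ ∞ := by
      intro h6
      rw [h6, ENNReal.mul_top (ENNReal.ofReal_pos.2 hδ0).ne'] at h3
      exact h3 rfl
    rw [← ENNReal.ofReal_toReal hM, ← ENNReal.ofReal_toReal h5, ← ENNReal.ofReal_mul hε.le,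
      ENNReal.ofReal_lt_ofReal_iff_of_nonneg (by positivity)] at h1
    rw [← ENNReal.ofReal_toReal hM, ← ENNReal.ofReal_toReal h4,
      ← ENNReal.ofReal_mul (by linarith), ENNReal.ofReal_lt_ofReal_iff_of_nonneg
        (mul_nonneg (by linarith) ENNReal.toReal_nonneg)] at h2
    rw [← ENNReal.ofReal_toReal hM, ← ENNReal.ofReal_toReal h5, ← ENNReal.ofReal_toReal h4,
      ← ENNReal.ofReal_mul hδ0.le, ← ENNReal.ofReal_mul (by positivity),
      ← ENNReal.ofReal_add (by positivity) (by positivity),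
      ENNReal.ofReal_le_ofReal_iff (by positivity)] at key
    have hM0 : 0 ≤ M.toReal := ENNReal.toReal_nonneg
    have h7 := mul_lt_mul_of_pos_left h1 hδ0
    have h8 := mul_le_mul_of_nonneg_left (mul_le_mul_of_nonneg_right hη2 hM0) hδ0.le
    linarith

/-- Under `Δ₂`, a modular bounded away from `1` forces a norm bounded away from `1`. -/
lemma DeltaTwo.exists_norm_le_one_sub {Φ : MusielakOrlicz μ} (hΔ : Φ.DeltaTwo) {δ : ℝ}
    (hδ : 0 < δ) (hδ1 : δ < 1) : ∃ η : ℝ, 0 < η ∧ ∀ u : Φ.Space,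
      Φ.modular u.toFun ≤ ENNReal.ofReal (1 - δ) → ‖u‖ ≤ 1 - η := by
  obtain ⟨K, H, hK, hH, h2⟩ := hΔ.exists_modular_two_smul_le
  -- Since `(1 + τ)u = (1 - τ)u + τ(2u)`, its modular is at most `1 - δ + τ(K + H)`, and this `τ`
  -- keeps that below `1`.
  obtain ⟨τ, hτ⟩ : ∃ τ, τ = min 1 (δ / (K + H + 1)) := ⟨_, rfl⟩
  have hτ0 : 0 < τ := by rw [hτ]; positivity
  have hτ1 : τ ≤ 1 := hτ ▸ min_le_left _ _
  have hτ2 : τ * (K + H + 1) ≤ δ := by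
    rw [← le_div_iff₀ (by positivity)]
    exact hτ ▸ min_le_right _ _
  refine ⟨1 - (1 + τ)⁻¹, sub_pos.2 (inv_lt_one_of_one_lt₀ (by linarith)), fun u hu => ?_⟩
  rw [sub_sub_cancel]
  refine Φ.norm_le_of u (by positivity) ?_
  have e : ((1 + τ)⁻¹)⁻¹ • u.toFun = (1 - τ) • u.toFun + τ • ((2 : ℝ) • u.toFun) := by
    rw [inv_inv]
    module
  rw [e]
  refine (Φ.modular_convex _ _ (by linarith) hτ0.le (by ring)).trans ?_
  calc _ ≤ ENNReal.ofReal (1 - τ) * ENNReal.ofReal (1 - δ) + ENNReal.ofReal τ *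
        (ENNReal.ofReal K * ENNReal.ofReal (1 - δ) + ENNReal.ofReal H) := by
        gcongr
        exact (h2 _).trans (by gcongr)
    _ = ENNReal.ofReal ((1 - τ) * (1 - δ) + τ * (K * (1 - δ) + H)) := by
        have hd : 0 ≤ 1 - δ := by linarith
        have ht : 0 ≤ 1 - τ := by linarith
        rw [← ENNReal.ofReal_mul ht, ← ENNReal.ofReal_mul hK,
          ← ENNReal.ofReal_add (by positivity) hH, ← ENNReal.ofReal_mul hτ0.le,
          ← ENNReal.ofReal_add (by positivity) (by positivity)]
    _ ≤ 1 := by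
        rw [ENNReal.ofReal_le_one]
        nlinarith [mul_pos hτ0 hδ, mul_nonneg hK (mul_pos hτ0 hδ).le]

/-- If the modular is uniformly convex and `Δ₂` holds, the Luxemburg norm is uniformly convex. -/
lemma UniformlyConvexModular.uniformConvexSpace {Φ : MusielakOrlicz μ} (hΔ : Φ.DeltaTwo)
    (h : Φ.UniformlyConvexModular) : UniformConvexSpace Φ.Space := by
  refine ⟨fun ε hε => ?_⟩
  -- A bound `ε / 4` on `‖(x - y)/2‖` gives `‖x - y‖ ≤ ε / 2`, contradicting `‖x - y‖ ≥ ε`.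
  obtain ⟨α, hα, hαn⟩ := hΔ.exists_norm_le_of_modular_le (ε := ε / 4) (by positivity)
  obtain ⟨δ, hδ, hδ1, hmod⟩ := h α hα
  obtain ⟨η, hη, hηn⟩ := hΔ.exists_norm_le_one_sub hδ hδ1
  refine ⟨2 * η, by positivity, fun x hx y hy hxy => ?_⟩
  have hM : (Φ.modular x.toFun + Φ.modular y.toFun) / 2 ≤ 1 := by
    refine ENNReal.div_le_of_le_mul ?_
    rw [one_mul, ← one_add_one_eq_two]
    exact add_le_add (Φ.modular_le_one_of_norm_le_one x hx.le)
      (Φ.modular_le_one_of_norm_le_one y hy.le)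
  have hhalf : ∀ z : Φ.Space, ‖(2 : ℝ)⁻¹ • z‖ = ‖z‖ / 2 := fun z => by
    rw [norm_smul, Real.norm_of_nonneg (by norm_num), div_eq_inv_mul]
  rcases hmod x y with h1 | h1
  · have h2 : ‖(2 : ℝ)⁻¹ • (x - y)‖ ≤ ε / 4 :=
      hαn ((2 : ℝ)⁻¹ • (x - y)) (h1.trans (mul_le_of_le_one_right' hM))
    rw [hhalf] at h2
    linarith
  · have h2 : ‖(2 : ℝ)⁻¹ • (x + y)‖ ≤ 1 - η :=
      hηn ((2 : ℝ)⁻¹ • (x + y)) (h1.trans (mul_le_of_le_one_right' hM))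
    rw [hhalf] at h2
    linarith

/-! ### Completeness and the modular uniformity -/

/-- Musielak–Orlicz spaces are complete. -/
lemma completeSpace (Φ : MusielakOrlicz μ) : CompleteSpace Φ.Space := by
  refine Metric.complete_of_convergent_controlled_sequences (fun n => (1 / 4) ^ n)
    (fun n => by positivity) fun u hu => ?_
  have hu' : ∀ N n m, N ≤ n → N ≤ m → ‖u n - u m‖ < (1 / 4) ^ N := fun N n m hn hm => by
    rw [← dist_eq_norm]
    exact hu N n m hn hm
  -- The rate `4^{-n}` leaves room for a factor `2^n`: the enlarged increments still have summable
  -- modulars, so they tend to `0` almost everywhere and the increments are eventually below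
  -- `2^{-n}`.
  have hsum : ∑' n, Φ.modular ((2 ^ n : ℝ) • (u (n + 1) - u n).toFun) ≠ ∞ := by
    have hle : ∀ n, Φ.modular ((2 ^ n : ℝ) • (u (n + 1) - u n).toFun) ≤
        ENNReal.ofReal ((1 / 2) ^ n) := fun n => by
      have e : (2 : ℝ) ^ n * (1 / 4) ^ n = (1 / 2) ^ n := by
        rw [← mul_pow]
        norm_num
      rw [← e]
      refine Φ.modular_smul_le_of_norm_lt _ (by positivity) ?_ (hu' n _ _ (Nat.le_succ n) le_rfl)
      rw [e]
      exact pow_le_one₀ (by norm_num) (by norm_num)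
    refine ne_top_of_le_ne_top ?_ (ENNReal.tsum_le_tsum hle)
    rw [← ENNReal.ofReal_tsum_of_nonneg (fun n => by positivity)
      (summable_geometric_of_lt_one (by norm_num) (by norm_num))]
    exact ENNReal.ofReal_ne_top
  have hlim : ∀ᵐ x ∂μ, ∃ l, Tendsto (fun n => (u n).toFun x) atTop (𝓝 l) := by
    filter_upwards [Φ.ae_tendsto_zero_of_tsum_modular _ hsum,
      ae_all_iff.2 fun n => ae_toFun_smul (2 ^ n) (u (n + 1) - u n).toFun,
      ae_all_iff.2 fun n => AEEqFun.coeFn_sub (u (n + 1)).toFun (u n).toFun] with x hx e1 e2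
    have e2' : ∀ n, (u (n + 1) - u n).toFun x = (u (n + 1)).toFun x - (u n).toFun x := e2
    simp only [e1, e2', abs_mul] at hx
    refine cauchySeq_tendsto_of_complete (cauchySeq_of_summable_dist ?_)
    refine Summable.of_norm_bounded_eventually_nat (g := fun n : ℕ => (1 / 2 : ℝ) ^ n)
      (summable_geometric_of_lt_one (by norm_num) (by norm_num)) ?_
    filter_upwards [hx.eventually (gt_mem_nhds one_pos)] with n hn
    rw [Real.norm_of_nonneg dist_nonneg, dist_comm, Real.dist_eq, one_div, inv_pow]
    rw [abs_of_pos (by positivity : (0 : ℝ) < 2 ^ n)] at hn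
    rw [← one_div, le_div_iff₀ (by positivity), mul_comm]
    exact hn.le
  obtain ⟨g, hg, hgu⟩ := exists_stronglyMeasurable_limit_of_tendsto_ae
    (fun n => (u n).toFun.aestronglyMeasurable) hlim
  set v : Ω →ₘ[μ] ℝ := AEEqFun.mk g hg.aestronglyMeasurable
  -- Fatou in `m` carries the Cauchy bound on `u N - u m` over to the limit. This gives the rate of
  -- convergence and also `v ∈ L^ρ`, as `v = u 0 - (u 0 - v)`.
  have hmod : ∀ N, Φ.modular ((((1 / 4) ^ N : ℝ))⁻¹ • ((u N).toFun - v)) ≤ 1 := by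
    intro N
    refine Φ.modular_le_of_ae_tendsto
      (u := fun m => (((1 / 4) ^ N : ℝ))⁻¹ • (u N - u m).toFun) ?_ ?_
    · filter_upwards [eventually_ge_atTop N] with m hm
      exact (Φ.modular_le_of_norm_lt _ (hu' N N m le_rfl hm)).2
    · filter_upwards [hgu, AEEqFun.coeFn_mk g hg.aestronglyMeasurable,
        ae_all_iff.2 fun m => ae_toFun_smul (((1 / 4) ^ N : ℝ))⁻¹ (u N - u m).toFun,
        ae_all_iff.2 fun m => AEEqFun.coeFn_sub (u N).toFun (u m).toFun,
        ae_toFun_smul (((1 / 4) ^ N : ℝ))⁻¹ ((u N).toFun - v),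
        AEEqFun.coeFn_sub (u N).toFun v] with x hx e1 e2 e3 e4 e5
      have e3' : ∀ m, (u N - u m).toFun x = (u N).toFun x - (u m).toFun x := e3
      simp only [e2, e3', e4, e5, Pi.sub_apply]
      rw [show v x = g x from e1]
      exact (tendsto_const_nhds.sub hx).const_mul _
  have hmem : ∀ N, (u N).toFun - v ∈ Φ.submodule := fun N =>
    ⟨(1 / 4) ^ N, by positivity, by
      simp only [modularMetric, sub_zero]
      exact (hmod N).trans_lt ENNReal.one_lt_top⟩
  have hv : v ∈ Φ.submodule := by
    have := Φ.submodule.sub_mem (u 0).2 (hmem 0)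
    have e : (Subtype.val (u 0)) - ((u 0).toFun - v) = v := sub_sub_cancel _ _
    rwa [e] at this
  obtain ⟨w, hw⟩ : ∃ w : Φ.Space, w.toFun = v := ⟨⟨v, hv⟩, rfl⟩
  rw [← hw] at hmod
  refine ⟨w, ?_⟩
  rw [tendsto_iff_dist_tendsto_zero]
  refine squeeze_zero (fun _ => dist_nonneg) (fun N => ?_)
    (tendsto_pow_atTop_nhds_zero_of_lt_one (by norm_num : (0 : ℝ) ≤ 1 / 4) (by norm_num))
  rw [dist_eq_norm]
  exact Φ.norm_le_of _ (by positivity) (hmod N)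

lemma dist_eq_basicMetricStar (Φ : MusielakOrlicz μ) (u v : Φ.Space) :
    dist u v = basicMetricStar Φ.modularMetric u.toFun v.toFun := by
  rw [dist_eq_norm]
  rfl

/-- The modular entourages form a basis of the norm uniformity. -/
lemma hasBasis_uniformity (Φ : MusielakOrlicz μ) :
    (uniformity Φ.Space).HasBasis (fun n : ℕ => 0 < n)
      (fun n => {p : Φ.Space × Φ.Space |
        (p.1.toFun, p.2.toFun) ∈ modularEntourage Φ.modularMetric n}) := by
  refine ⟨fun t => ⟨fun ht => ?_, ?_⟩⟩
  · obtain ⟨ε, hε, h⟩ := Metric.mem_uniformity_dist.1 ht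
    obtain ⟨n, hn⟩ := exists_nat_one_div_lt hε
    -- As `1 / (n + 1) ≤ 1`, membership in this entourage bounds the modular at scale `1 / (n + 1)`
    -- by `1`, hence the norm by `1 / (n + 1)`.
    refine ⟨n + 1, n.succ_pos, fun ⟨u, v⟩ hp => h ?_⟩
    refine lt_of_le_of_lt ?_ hn
    rw [dist_eq_norm]
    refine Φ.norm_le_of _ (by positivity) ?_
    have h1 : Φ.modular ((1 / ((n + 1 : ℕ) : ℝ))⁻¹ • (u.toFun - v.toFun)) <
      1 / ((n + 1 : ℕ) : ℝ≥0∞) := hp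
    rw [Nat.cast_succ] at h1
    refine h1.le.trans ?_
    rw [one_div, ENNReal.inv_le_one]
    exact_mod_cast Nat.succ_le_succ n.zero_le
  · rintro ⟨n, hn, hsub⟩
    have hn' : (1 : ℝ) ≤ n := by exact_mod_cast hn
    -- Multiplying by `n` turns this radius into `1 / (2n)`, which bounds the modular; the factor
    -- `2` makes the inequality with `1 / n` strict.
    refine mem_of_superset (Metric.dist_mem_uniformity (ε := 1 / (2 * (n : ℝ) ^ 2))
      (by positivity)) (Set.Subset.trans ?_ hsub)
    rintro ⟨u, v⟩ hp
    have hp' : ‖u - v‖ < 1 / (2 * (n : ℝ) ^ 2) := by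
      rw [← dist_eq_norm]
      exact hp
    have e : (1 / (n : ℝ))⁻¹ * (1 / (2 * (n : ℝ) ^ 2)) = 1 / (2 * n) := by
      field_simp
    have h2 : 1 / (2 * (n : ℝ)) < 1 / n := by
      apply one_div_lt_one_div_of_lt <;> linarith
    have h3 : 1 / (n : ℝ) ≤ 1 := by rw [div_le_one (by linarith)]; exact hn'
    have h1 := Φ.modular_smul_le_of_norm_lt (u - v) (a := (1 / (n : ℝ))⁻¹) (by positivity)
      (by rw [e]; linarith) hp'
    refine lt_of_le_of_lt h1 ?_
    rw [e]
    have h4 : (1 : ℝ≥0∞) / n = ENNReal.ofReal (1 / n) := by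
      rw [ENNReal.ofReal_div_of_pos (by linarith)]
      simp
    rw [h4]
    exact (ENNReal.ofReal_lt_ofReal_iff (by positivity)).2 h2

end MusielakOrlicz

end

theorem mainTheorem10 {Ω : Type*} [MeasurableSpace Ω] (μ : Measure Ω) (Φ : MusielakOrlicz μ)
    (hΔ : Φ.DeltaTwo)
    (huc : Φ.UniformlyConvexIntegrand ∨ Φ.UniformlyConvexModular) :
    -- the Luxemburg metric is `d_w^*`, and the modular uniformity is the norm uniformity
    (∀ u v : Φ.Space, dist u v = basicMetricStar Φ.modularMetric u.toFun v.toFun) ∧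
    ((uniformity Φ.Space).HasBasis (fun n : ℕ => 0 < n)
      (fun n => {p : Φ.Space × Φ.Space |
        (p.1.toFun, p.2.toFun) ∈ modularEntourage Φ.modularMetric n})) ∧
    -- `L^ρ` is a uniformly convex, reflexive Banach space
    UniformConvexSpace Φ.Space ∧
    CompleteSpace Φ.Space ∧
    Function.Surjective (NormedSpace.inclusionInDoubleDual ℝ Φ.Space) ∧
    -- bounded sets are relatively compact, and bounded sequences have convergent subsequences,
    -- in the weak topology
    (∀ B : Set Φ.Space, Bornology.IsBounded B →
      IsCompact (closure (toWeakSpace ℝ Φ.Space '' B))) ∧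
    (∀ u : ℕ → Φ.Space, Bornology.IsBounded (Set.range u) →
      ∃ (v : Φ.Space) (k : ℕ → ℕ), StrictMono k ∧
        ∀ F : StrongDual ℝ Φ.Space, Tendsto (fun n => F (u (k n))) atTop (𝓝 (F v))) ∧
    -- continuous functionals attain their norm on the closed unit ball
    (∀ F : StrongDual ℝ Φ.Space, ∃ u : Φ.Space, ‖u‖ ≤ 1 ∧ F u = ‖F‖) ∧
    -- nonempty closed convex sets have unique nearest points
    (∀ C : Set Φ.Space, C.Nonempty → IsClosed C → Convex ℝ C →
      ∀ u : Φ.Space, ∃! v : Φ.Space, v ∈ C ∧ ∀ z ∈ C, dist u v ≤ dist u z) ∧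
    -- weak convergence together with convergence of the norms implies norm convergence
    (∀ (u : ℕ → Φ.Space) (v : Φ.Space),
      (∀ F : StrongDual ℝ Φ.Space, Tendsto (fun n => F (u n)) atTop (𝓝 (F v))) →
      Tendsto (fun n => ‖u n‖) atTop (𝓝 ‖v‖) → Tendsto u atTop (𝓝 v)) := by
  have hmod : Φ.UniformlyConvexModular :=
    huc.elim MusielakOrlicz.UniformlyConvexIntegrand.uniformlyConvexModular id
  have : UniformConvexSpace Φ.Space := hmod.uniformConvexSpace hΔ
  have : CompleteSpace Φ.Space := Φ.completeSpace
  have hrefl : Function.Surjective (NormedSpace.inclusionInDoubleDual ℝ Φ.Space) :=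
    UniformConvexSpace.surjective_inclusionInDoubleDual
  exact ⟨Φ.dist_eq_basicMetricStar, Φ.hasBasis_uniformity, inferInstance, inferInstance, hrefl,
    fun _ hB => isCompact_closure_toWeakSpace_image_of_isBounded hrefl hB,
    fun _ hu => UniformConvexSpace.exists_subseq_weak_tendsto hu,
    exists_norm_le_one_apply_eq_norm hrefl,
    fun _ hne hcl hconv u => UniformConvexSpace.existsUnique_nearest hne hcl hconv u,
    fun _ _ hw hn => UniformConvexSpace.tendsto_of_weak_tendsto_of_norm_tendsto hw hn⟩
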